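/- A trinomial over $\mathrm{GF}(2)$ is a polynomial $T(x)=x^n+x^s+1\in\mathrm{GF}(2)[x]$ with integers $n>s>0$. A polynomial $P\in\mathrm{GF}(2)[x]$ of degree $n$ is called almost irreducible, with exponent $r$ and increment $\delta=n-r$, if $P(0)\neq 0$, $r>n/2$ and $P$ has an irreducible factor over $\mathrm{GF}(2)$ of degree $r$. **Theorem.** If $T$ is an almost irreducible trinomial over $\mathrm{GF}(2)$ with exponent $216091$ and increment $\delta$, then $\delta\notin\{0,1,2,4,6\}$. -/

import Mathlib

open Polynomial

/-- A trinomial over `GF(2)`: a polynomial `x^n + x^s + 1` with `n > s > 0`. -/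
def IsTrinomial (T : (ZMod 2)[X]) : Prop :=
  ∃ n s : ℕ, 0 < s ∧ s < n ∧ T = X ^ n + X ^ s + 1

/-- `P` is almost irreducible over `GF(2)`, with exponent `r` and increment `δ`: writing `n` for the
degree of `P`, one has `P(0) ≠ 0`, and `P` has an irreducible factor of degree `r`, where `r > n / 2`
and `n = r + δ`. -/
structure IsAlmostIrreducible (P : (ZMod 2)[X]) (r δ : ℕ) : Prop where
  eval_zero_ne_zero : P.eval 0 ≠ 0
  natDegree_lt_two_mul : P.natDegree < 2 * r
  exists_irreducible_factor : ∃ D : (ZMod 2)[X], Irreducible D ∧ D ∣ P ∧ D.natDegree = r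
  natDegree_eq_add : P.natDegree = r + δ

/-! Write `T = P * Q` with `P` irreducible of degree 216091 and `Q` of degree `δ`. A trinomial has
no root in GF(2), so `δ ≠ 1`, and a quadratic `Q` would be `X ^ 2 + X + 1`, which divides no
trinomial of degree divisible by 3, such as 216093. In the remaining cases `n` is odd, and passing
to the reciprocal polynomial makes the middle exponent `k` odd. Each case then ends by forcing `X ^
2 + X + 1` to divide `T`, a condition on `n` and `k` modulo 3, although the irreducible factors of
`T` have other degrees.

For `δ = 4`, the roots of `Q` are 15th roots of unity, which fixes `k` modulo 3. For `δ = 0` and `δ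
= 6` the tool is Swan's theorem `exists_frobenius_perm_trinomial`: unless `n - k` divides `2 * n`,
squaring permutes the roots evenly exactly when `n ≡ ±1` modulo 8. An irreducible `T` of odd degree
gives an even permutation, but 216091 ≡ 3; an irreducible sextic `Q` gives an odd one, but 216097 ≡
1. So `n - k` divides `2 * n`, and the prime factors of `n` leave only values of `k` for which `X ^
2 + X + 1` divides `T`.

Swan's theorem is proved by lifting the roots to a ring of integers. A Frobenius element above 2
multiplies the Vandermonde determinant `Δ` by the sign of the permutation. Since `Δ ^ 2` is the
discriminant, congruent to `± n ^ n` modulo 8, the sign can be read off from the quadratic equation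
of `(1 + Δ) / 2` modulo 2. -/

/-! ### The discriminant of a trinomial modulo 8. -/

/-- If the first two elementary symmetric functions of the `z i` vanish, then
`∏ (a + 2 u z i)` agrees with `a ^ n` modulo `8`. -/
theorem eight_dvd_prod_add_sub_pow {R : Type*} [CommRing R] {n : ℕ} (z : Fin n → R) (a u : R)
    (h₁ : ∑ t ∈ Finset.powersetCard 1 Finset.univ, ∏ i ∈ t, z i = 0)
    (h₂ : ∑ t ∈ Finset.powersetCard 2 Finset.univ, ∏ i ∈ t, z i = 0) :
    8 ∣ ∏ i, (a + 2 * u * z i) - a ^ n := by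
  have key : ∏ i, (a + 2 * u * z i) = ∑ j ∈ Finset.range (n + 1),
      (2 * u) ^ j * a ^ (n - j) * ∑ t ∈ Finset.powersetCard j Finset.univ, ∏ i ∈ t, z i := by
    simp_rw [add_comm a]
    rw [Finset.prod_add, Finset.sum_powerset]
    simp only [Finset.card_univ, Fintype.card_fin]
    refine Finset.sum_congr rfl fun j _ ↦ ?_
    rw [Finset.mul_sum]
    refine Finset.sum_congr rfl fun t ht ↦ ?_
    rw [Finset.mem_powersetCard] at ht
    rw [Finset.prod_mul_distrib, Finset.prod_const, Finset.prod_const, Finset.card_univ_sdiff,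
      Fintype.card_fin, ht.2]
    ring
  rw [key, Finset.sum_range_succ']
  simp only [pow_zero, tsub_zero, one_mul, Finset.powersetCard_zero, Finset.sum_singleton,
    Finset.prod_empty, mul_one, add_sub_cancel_right]
  refine Finset.dvd_sum fun j _ ↦ ?_
  match j with
  | 0 => simp [h₁]
  | 1 => simp [h₂]
  | j + 2 =>
    refine Dvd.dvd.mul_right (Dvd.dvd.mul_right ⟨2 ^ j * u ^ (j + 2 + 1), ?_⟩ _) _
    ring

/-- Newton's identities for a family of elements of a commutative ring. -/
theorem sum_pow_eq_mul_esymm_sub_sum {R : Type*} [CommRing R] {n : ℕ} (z : Fin n → R) {m : ℕ}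
    (hm : 0 < m) :
    ∑ i, z i ^ m = (-1) ^ (m + 1) * m * (∑ t ∈ Finset.powersetCard m Finset.univ, ∏ i ∈ t, z i) -
      ∑ a ∈ Finset.HasAntidiagonal.antidiagonal m with a.1 ∈ Set.Ioo 0 m, (-1) ^ a.1 *
        (∑ t ∈ Finset.powersetCard a.1 Finset.univ, ∏ i ∈ t, z i) * ∑ i, z i ^ a.2 := by
  have h := congrArg (MvPolynomial.aeval z) (MvPolynomial.psum_eq_mul_esymm_sub_sum (Fin n) R m hm)
  simpa [MvPolynomial.psum, MvPolynomial.esymm] using h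

/-- Newton's identity `2 e₂ = e₁ p₁ - p₂`, with 2 cancellable. -/
theorem esymm_two_eq_zero {R : Type*} [CommRing R] [IsDomain R] [CharZero R] {n : ℕ}
    (z : Fin n → R) (h₁ : ∑ i, z i = 0) (h₂ : ∑ i, z i ^ 2 = 0) :
    ∑ t ∈ Finset.powersetCard 2 Finset.univ, ∏ i ∈ t, z i = 0 := by
  have h := sum_pow_eq_mul_esymm_sub_sum z (m := 2) (by norm_num)
  rw [Finset.sum_eq_zero (s := Finset.filter _ _), h₂] at h
  · simpa using h.symm
  · intro a ha
    simp only [Finset.mem_filter, Finset.HasAntidiagonal.mem_antidiagonal, Set.mem_Ioo] at ha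
    have : a.1 = 1 := by omega
    rw [show a.2 = 1 by omega]
    simp [h₁]

theorem esymm_eq_coeff {R : Type*} [CommRing R] {n : ℕ} (z : Fin n → R) {m : ℕ} (hm : m ≤ n) :
    ∑ t ∈ Finset.powersetCard m Finset.univ, ∏ i ∈ t, z i =
      (-1) ^ m * (∏ i, (X - C (z i))).coeff (n - m) := by
  have h := Multiset.prod_X_sub_C_coeff (Finset.univ.val.map z) (k := n - m) (by simp)
  simp only [Multiset.map_map, Function.comp_def, Multiset.card_map, Finset.card_val,
    Finset.card_univ, Fintype.card_fin, Finset.esymm_map_val, Nat.sub_sub_self hm] at h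
  rw [Finset.prod_eq_multiset_prod, h, ← mul_assoc, ← mul_pow]
  simp

/-- Power sums of the roots of `X ^ n + X ^ k + 1` vanish outside the semigroup generated by
`n - k` and `n` (in the range `m < 2 n`). -/
theorem sum_pow_trinomial_roots_eq_zero {R : Type*} [CommRing R] {n k : ℕ} (hk : 0 < k)
    (hkn : k < n) (y : Fin n → R) (hy : (X ^ n + X ^ k + 1 : R[X]) = ∏ i, (X - C (y i)))
    (m : ℕ) (hm : 0 < m) (hmn : m < 2 * n) (h₁ : ¬ (n - k) ∣ m) (h₂ : ∀ i, m ≠ n + i * (n - k)) :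
    ∑ i, y i ^ m = 0 := by
  -- In positive degree only `e_{n-k}` and `e_n` can be nonzero, so Newton's recursion for `p_m`
  -- reaches only `p_{m-(n-k)}` and `p_{m-n}`.
  have he : ∀ j, 0 < j → j ≠ n - k → j ≠ n →
      ∑ t ∈ Finset.powersetCard j Finset.univ, ∏ i ∈ t, y i = 0 := by
    intro j hj hj₁ hj₂
    rcases lt_or_ge n j with h | h
    · rw [Finset.powersetCard_eq_empty.2 (by simpa using h), Finset.sum_empty]
    · rw [esymm_eq_coeff y h, ← hy]
      simp only [coeff_add, coeff_X_pow, coeff_one]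
      rw [if_neg (by omega), if_neg (by omega), if_neg (by omega)]
      simp
  induction m using Nat.strong_induction_on with
  | _ m ih =>
    rw [sum_pow_eq_mul_esymm_sub_sum y hm, he m hm (fun h ↦ h₁ (h ▸ dvd_rfl))
      (by simpa using h₂ 0), mul_zero, zero_sub, neg_eq_zero]
    refine Finset.sum_eq_zero fun a ha ↦ ?_
    simp only [Finset.mem_filter, Finset.HasAntidiagonal.mem_antidiagonal, Set.mem_Ioo] at ha
    obtain ⟨ha, ha₀, ham⟩ := ha
    by_cases hs : a.1 = n - k
    · rw [ih a.2 (by omega) (by omega) (by omega), mul_zero]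
      · exact fun h ↦ h₁ (by rw [← ha, hs]; exact dvd_add dvd_rfl h)
      · intro i hi
        exact h₂ (i + 1) (by rw [← ha, hi, hs]; ring)
    · by_cases hn : a.1 = n
      · rw [ih a.2 (by omega) (by omega) (by omega), mul_zero]
        · rintro ⟨c, hc⟩
          exact h₂ c (by rw [← ha, hn, hc, mul_comm])
        · intro i hi
          omega
      · rw [he a.1 ha₀ hs hn, mul_zero, zero_mul]

/-- At a root, `y f'(y) = n y^n + k y^k = -(n + (n - k) y^k)`. For odd `n` the product of the roots
is `-1`, which cancels the `n` minus signs. -/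
theorem prod_derivative_trinomial {R : Type*} [CommRing R] {n k : ℕ} (hk : 0 < k) (hkn : k < n)
    (hn : Odd n) (y : Fin n → R) (hy : (X ^ n + X ^ k + 1 : R[X]) = ∏ i, (X - C (y i))) :
    ∏ i, (derivative (X ^ n + X ^ k + 1 : R[X])).eval (y i) =
      ∏ i, ((n : R) + ((n - k : ℕ) : R) * y i ^ k) := by
  have hroot : ∀ i, y i ^ n + y i ^ k + 1 = 0 := fun i ↦ by
    have := congrArg (eval (y i)) hy
    rw [eval_prod, Finset.prod_eq_zero (Finset.mem_univ i) (by simp)] at this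
    simpa using this
  have hprod : ∏ i, y i = -1 := by
    have := congrArg (eval 0) hy
    simp only [eval_add, eval_pow, eval_X, eval_one, eval_prod, eval_sub, eval_C, zero_sub,
      Finset.prod_neg, Finset.card_univ, Fintype.card_fin, hn.neg_one_pow] at this
    rw [zero_pow (by omega), zero_pow (by omega)] at this
    linear_combination this
  have h : (∏ i, y i) * ∏ i, (derivative (X ^ n + X ^ k + 1 : R[X])).eval (y i) =
      (-1) ^ n * ∏ i, ((n : R) + ((n - k : ℕ) : R) * y i ^ k) := by
    rw [← Finset.prod_mul_distrib]
    have : (-1 : R) ^ n = ∏ _i : Fin n, (-1 : R) := by simp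
    rw [this, ← Finset.prod_mul_distrib]
    refine Finset.prod_congr rfl fun i _ ↦ ?_
    have e₁ : y i * y i ^ (n - 1) = y i ^ n := by rw [← pow_succ', Nat.sub_add_cancel (by omega)]
    have e₂ : y i * y i ^ (k - 1) = y i ^ k := by rw [← pow_succ', Nat.sub_add_cancel (by omega)]
    simp only [derivative_add, derivative_X_pow, derivative_one, eval_add, eval_mul, eval_pow,
      eval_X, add_zero, eval_C, Nat.cast_sub hkn.le]
    linear_combination (n : R) * e₁ + (k : R) * e₂ + (n : R) * hroot i
  rw [hprod, hn.neg_one_pow] at h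
  linear_combination -h

/-- The square of the Vandermonde determinant is the discriminant. -/
theorem det_vandermonde_sq {R : Type*} [CommRing R] {n : ℕ} (y : Fin n → R) :
    (Matrix.vandermonde y).det ^ 2 =
      (-1) ^ (n * (n - 1) / 2) * ∏ i, (derivative (∏ i, (X - C (y i)))).eval (y i) := by
  have h : ∀ i, (derivative (∏ i, (X - C (y i)))).eval (y i) =
      (∏ j ∈ Finset.Ioi i, (y i - y j)) * ∏ j ∈ Finset.Iio i, (y i - y j) := by
    intro i
    rw [derivative_prod_finset, eval_finsetSum, Finset.sum_eq_single i]
    · rw [← Finset.prod_union]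
      · simp only [derivative_sub, derivative_X, derivative_C, sub_zero, mul_one, eval_prod,
          eval_sub, eval_X, eval_C]
        refine Finset.prod_congr ?_ fun _ _ ↦ rfl
        ext j
        simp [eq_comm]
      · rw [Finset.disjoint_left]
        intro j hj hj'
        simp only [Finset.mem_Ioi, Finset.mem_Iio] at hj hj'
        exact lt_asymm hj hj'
    · intro j _ hj
      rw [eval_mul, eval_prod, Finset.prod_eq_zero (i := i) (by simp [hj.symm]) (by simp), zero_mul]
    · simp
  have hcard : ∏ i : Fin n, ∏ _j ∈ Finset.Ioi i, (-1 : R) = (-1) ^ (n * (n - 1) / 2) := by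
    simp only [Finset.prod_const, Fin.card_Ioi, Finset.prod_pow_eq_pow_sum]
    congr 1
    rw [← Finset.sum_range_id, ← Finset.sum_range_reflect, Finset.sum_range]
  have hswap : ∏ i : Fin n, ∏ j ∈ Finset.Iio i, (y i - y j) =
      ∏ i : Fin n, ∏ j ∈ Finset.Ioi i, (y j - y i) :=
    Finset.prod_comm' (by simp)
  simp_rw [h]
  have hneg : ∏ i : Fin n, ∏ j ∈ Finset.Ioi i, (y j - y i) =
      (-1) ^ (n * (n - 1) / 2) * ∏ i : Fin n, ∏ j ∈ Finset.Ioi i, (y i - y j) := by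
    rw [← hcard, ← Finset.prod_mul_distrib]
    refine Finset.prod_congr rfl fun i _ ↦ ?_
    rw [← Finset.prod_mul_distrib]
    exact Finset.prod_congr rfl fun j _ ↦ by ring
  rw [Finset.prod_mul_distrib, hswap, Matrix.det_vandermonde, sq, ← mul_assoc, ← hneg]

/-- The discriminant of a trinomial `X ^ n + X ^ k + 1` modulo `8`. -/
theorem eight_dvd_det_vandermonde_sq_sub {R : Type*} [CommRing R] [IsDomain R] [CharZero R]
    {n k : ℕ} (hk : Odd k) (hkn : k < n) (hn : Odd n) (hdvd : ¬ (n - k) ∣ 2 * n) (y : Fin n → R)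
    (hy : (X ^ n + X ^ k + 1 : R[X]) = ∏ i, (X - C (y i))) :
    8 ∣ (Matrix.vandermonde y).det ^ 2 - (-1) ^ (n * (n - 1) / 2) * (n : R) ^ n := by
  obtain ⟨u, hu⟩ := (Nat.Odd.sub_odd hn hk).two_dvd
  have hz₁ : ∑ i, y i ^ k = 0 := by
    refine sum_pow_trinomial_roots_eq_zero hk.pos hkn y hy k hk.pos (by omega) ?_ ?_
    · rintro ⟨c, hc⟩
      rw [hu, mul_assoc] at hc
      exact (Nat.not_even_iff_odd.2 hk) (hc ▸ even_two_mul _)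
    · intro i hi
      have := Nat.le_add_right n (i * (n - k))
      omega
  have hz₂ : ∑ i, (y i ^ k) ^ 2 = 0 := by
    simp_rw [← pow_mul]
    refine sum_pow_trinomial_roots_eq_zero hk.pos hkn y hy _ (by have := hk.pos; omega)
      (by omega) ?_ ?_
    -- Since `2n = 2k + 2(n - k)`, a divisor `n - k` of `2k` would also divide `2n`.
    · intro h
      refine hdvd ?_
      have : 2 * n = k * 2 + (n - k) * 2 := by omega
      rw [this]
      exact dvd_add h (dvd_mul_right _ _)
    -- Parity: `2k` is even, while `n + i(n - k)` is odd.
    · intro i hi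
      rw [hu, mul_comm i, mul_assoc] at hi
      have := hn
      rw [Nat.odd_iff] at this
      omega
  have h := eight_dvd_prod_add_sub_pow (fun i ↦ y i ^ k) (n : R) (u : R)
    (by simpa [Finset.powersetCard_one] using hz₁) (esymm_two_eq_zero _ hz₁ hz₂)
  rw [det_vandermonde_sq, ← mul_sub, ← hy, prod_derivative_trinomial hk.pos hkn hn y hy]
  refine Dvd.dvd.mul_left ?_ _
  simpa [hu] using h

/-! ### Lifting Frobenius to characteristic zero, and Swan's theorem. -/

theorem exists_galois_numberField_splits (g : ℚ[X]) :
    ∃ (L : Type) (_ : Field L) (_ : NumberField L), IsGalois ℚ L ∧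
      (g.map (algebraMap ℚ L)).Splits := by
  -- The splitting field carries its own `ℚ`-algebra structure; this transports to the canonical one
  -- used by `NumberField`.
  have key : ∀ A : Algebra ℚ g.SplittingField, @IsSplittingField ℚ g.SplittingField _ _ A g →
      @IsSplittingField ℚ g.SplittingField _ _ DivisionRing.toRatAlgebra g :=
    fun A h ↦ Subsingleton.elim A DivisionRing.toRatAlgebra ▸ h
  have h := key _ (IsSplittingField.splittingField g)
  have hn : Normal ℚ g.SplittingField := Normal.of_isSplittingField g
  exact ⟨g.SplittingField, inferInstance,
    { to_charZero := inferInstance, to_finiteDimensional := IsSplittingField.finiteDimensional g.SplittingField g },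
    IsGalois.mk, h.splits⟩

theorem exists_family_of_splits_of_monic {L : Type*} [Field L] {f : L[X]} (hf : f.Splits)
    (hm : f.Monic) {n : ℕ} (hn : f.natDegree = n) :
    ∃ y : Fin n → L, f = ∏ i, (X - C (y i)) := by
  have hc : f.roots.toList.length = n := by
    rw [Multiset.length_toList, ← hf.natDegree_eq_card_roots, hn]
  subst hc
  refine ⟨fun i ↦ f.roots.toList[i], ?_⟩
  have h := hf.eq_prod_roots_of_monic hm
  rw [← Multiset.coe_toList f.roots, Multiset.map_coe, Multiset.prod_coe] at h
  conv_lhs => rw [h]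
  exact (Fin.prod_univ_fun_getElem _ _).symm

/-- A monic integral polynomial splits over an integrally closed domain of characteristic zero
carrying a lift of the Frobenius of a finite residue field of characteristic `2`. -/
theorem exists_frobenius_lift (g : ℤ[X]) (hg : g.Monic) {n : ℕ} (hn : g.natDegree = n) :
    ∃ (O : Type) (_ : CommRing O) (_ : IsDomain O) (_ : CharZero O) (_ : IsIntegrallyClosed O)
      (k : Type) (_ : Field k) (_ : Finite k) (_ : CharP k 2) (φ : O →+* k) (σ : O →+* O)
      (y : Fin n → O), (∀ x, φ (σ x) = φ x ^ 2) ∧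
        g.map (Int.castRingHom O) = ∏ i, (X - C (y i)) := by
  obtain ⟨L, _, _, _, hsplit⟩ := exists_galois_numberField_splits (g.map (Int.castRingHom ℚ))
  let O := NumberField.RingOfIntegers L
  have hmax : (Ideal.span {((2 : ℕ) : ℤ)}).IsMaximal :=
    Int.ideal_span_isMaximal_of_prime 2
  obtain ⟨M, hM, hover⟩ := Ideal.exists_maximal_ideal_liesOver_of_isIntegral (S := O)
    (Ideal.span {((2 : ℕ) : ℤ)})
  have h2 : (2 : O) ∈ M := by
    have : (2 : ℤ) ∈ M.under ℤ := hover.over ▸ Ideal.mem_span_singleton_self _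
    simpa [Ideal.under] using this
  have hbot : M ≠ ⊥ := by
    rintro rfl
    simp at h2
  have : Finite (O ⧸ M) := Ideal.finiteQuotientOfFreeOfNeBot M hbot
  let _ : Field (O ⧸ M) := Ideal.Quotient.field M
  have : CharP (O ⧸ M) 2 := CharTwo.of_one_ne_zero_of_two_eq_zero one_ne_zero
    (Ideal.Quotient.eq_zero_iff_mem.2 h2)
  have : IsGaloisGroup Gal(L/ℚ) ℤ O := IsGaloisGroup.of_isFractionRing _ _ _ ℚ L
  have : Algebra.IsInvariant ℤ O Gal(L/ℚ) := inferInstance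
  obtain ⟨τ, hτ⟩ := IsArithFrobAt.exists_of_isInvariant ℤ Gal(L/ℚ) M
  have hcard : Nat.card (ℤ ⧸ M.under ℤ) = 2 := by
    rw [← hover.over, Nat.card_congr (Int.quotientSpanNatEquivZMod 2).toEquiv, Nat.card_zmod]
  have hy : ∃ y : Fin n → O, g.map (Int.castRingHom O) = ∏ i, (X - C (y i)) := by
    rw [map_map, Subsingleton.elim ((algebraMap ℚ L).comp (Int.castRingHom ℚ)) (algebraMap ℤ L)]
      at hsplit
    obtain ⟨y, hy⟩ := exists_family_of_splits_of_monic hsplit (hg.map _) ((hg.natDegree_map _).trans hn)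
    have hint : ∀ i, ∃ z : O, algebraMap O L z = y i := fun i ↦ by
      refine (IsIntegralClosure.isIntegral_iff (R := ℤ)).1 ⟨g, hg, ?_⟩
      have := congrArg (eval (y i)) hy
      rw [eval_prod, Finset.prod_eq_zero (Finset.mem_univ i) (by simp), eval_map] at this
      exact this
    choose z hz using hint
    refine ⟨z, map_injective (algebraMap O L) (FaithfulSMul.algebraMap_injective O L) ?_⟩
    rw [map_map, Polynomial.map_prod,
      Subsingleton.elim ((algebraMap O L).comp (Int.castRingHom O)) (algebraMap ℤ L), hy]
    simp [hz]
  obtain ⟨y, hy⟩ := hy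
  refine ⟨O, inferInstance, inferInstance, inferInstance, inferInstance, O ⧸ M, inferInstance,
    inferInstance, inferInstance, Ideal.Quotient.mk M,
    MulSemiringAction.toRingHom Gal(L/ℚ) O τ, y, fun x ↦ ?_, hy⟩
  rw [← map_pow, Ideal.Quotient.eq]
  have := hτ x
  rw [hcard] at this
  exact this

/-- If `Δ ^ 2 ≡ 1 + 4 c` modulo `8`, then a lift of the Frobenius in residue characteristic `2`
fixes `Δ` if and only if `c` is even. -/
theorem frobenius_sign_eq_one_iff {O k : Type*} [CommRing O] [IsDomain O] [CharZero O]
    [IsIntegrallyClosed O] [Field k] [CharP k 2] (φ : O →+* k) (σ : O →+* O)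
    (hφ : ∀ x, φ (σ x) = φ x ^ 2) (Δ : O) (c : ℤ) (hΔ : 8 ∣ Δ ^ 2 - (1 + 4 * c)) (ε : ℤˣ)
    (hε : σ Δ = ((ε : ℤ) : O) * Δ) : ε = 1 ↔ Even c := by
  obtain ⟨w, hw⟩ := hΔ
  have h2 : (2 : O) ≠ 0 := two_ne_zero
  have h2k : (2 : k) = 0 := CharTwo.two_eq_zero
  obtain ⟨θ, hθ⟩ : ∃ θ : O, 2 * θ = 1 + Δ := by
    let K := FractionRing O
    have hinj : Function.Injective (algebraMap O K) := IsFractionRing.injective O K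
    have h2' : (2 : K) ≠ 0 := two_ne_zero
    obtain ⟨t, ht⟩ : ∃ t : K, 2 * t = 1 + algebraMap O K Δ :=
      ⟨(1 + algebraMap O K Δ) / 2, mul_div_cancel₀ _ h2'⟩
    have hx : IsIntegral O t := by
      -- For `t = (1 + Δ) / 2` one has `t² - t = (Δ² - 1) / 4 = c + 2w`.
      refine ⟨X ^ 2 - X - C ((c : O) + 2 * w), by monicity!, ?_⟩
      have := congrArg (algebraMap O K) hw
      simp only [map_sub, map_pow, map_add, map_one, map_mul, map_ofNat] at this
      rw [eval₂_sub, eval₂_sub, eval₂_X_pow, eval₂_X, eval₂_C, map_add, map_mul, map_ofNat]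
      refine mul_left_cancel₀ (mul_ne_zero h2' h2') ?_
      linear_combination this + (2 * t - 1 + algebraMap O K Δ) * ht
    obtain ⟨θ, hθ⟩ := IsIntegrallyClosed.algebraMap_eq_of_integral hx
    refine ⟨θ, hinj ?_⟩
    rw [map_mul, hθ, map_ofNat, map_add, map_one, ht]
  have hΔ : Δ = 2 * θ - 1 := by linear_combination -hθ
  subst hΔ
  have hquad : θ ^ 2 - θ = c + 2 * w := by
    refine mul_left_cancel₀ (mul_ne_zero h2 h2) ?_
    linear_combination hw
  have hk : φ θ ^ 2 = φ θ + (c : k) := by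
    have := congrArg φ hquad
    simp only [map_sub, map_pow, map_add, map_mul, map_ofNat, map_intCast] at this
    linear_combination this + φ w * h2k
  have hfrob := hφ θ
  simp only [map_sub, map_mul, map_ofNat, map_one] at hε
  rcases Int.units_eq_one_or ε with rfl | rfl
  · have : σ θ = θ := by
      refine mul_left_cancel₀ h2 ?_
      simp at hε
      linear_combination 2 * hε
    rw [this, hk] at hfrob
    have hc : (c : k) = 0 := by linear_combination -hfrob
    rw [CharP.intCast_eq_zero_iff k 2] at hc
    simpa using even_iff_two_dvd.2 hc
  · have : σ θ = 1 - θ := by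
      refine mul_left_cancel₀ h2 ?_
      simp at hε
      linear_combination hε
    rw [this, hk, map_sub, map_one] at hfrob
    have hc : ((c - 1 : ℤ) : k) = 0 := by
      push_cast
      linear_combination -hfrob - φ θ * h2k
    rw [CharP.intCast_eq_zero_iff k 2] at hc
    have h : ¬ Even c := by
      rw [Int.even_iff]
      omega
    simp [h]

/-- Odd squares are 1 modulo 8, so `n ^ n ≡ n`; with `n = 2m + 1` the sign is `(-1) ^ m`. -/
theorem eight_dvd_neg_one_pow_mul_pow_sub {n : ℕ} (hn : Odd n) :
    ∃ c : ℤ, (8 : ℤ) ∣ (-1) ^ (n * (n - 1) / 2) * (n : ℤ) ^ n - (1 + 4 * c) ∧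
      (Even c ↔ n % 8 = 1 ∨ n % 8 = 7) := by
  obtain ⟨m, rfl⟩ := hn
  have h₁ : (2 * m + 1) * (2 * m + 1 - 1) / 2 = 2 * (m * m) + m := by
    rw [Nat.add_sub_cancel]
    refine Nat.div_eq_of_eq_mul_left two_pos ?_
    ring
  have h₂ : ((2 * m + 1 : ℕ) : ℤ) ^ (2 * m + 1) ≡ 2 * m + 1 [ZMOD 8] := by
    have hsq : ((2 * m + 1 : ℕ) : ℤ) ^ 2 ≡ 1 [ZMOD 8] :=
      (Int.modEq_of_dvd (Int.eight_dvd_sq_sub_one_of_odd ⟨m, by push_cast; ring⟩)).symm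
    rw [pow_succ, pow_mul]
    simpa using (hsq.pow m).mul_right ((2 * m + 1 : ℕ) : ℤ)
  have h₃ : ∀ c : ℤ, (8 : ℤ) ∣ (-1) ^ m * (2 * m + 1) - (1 + 4 * c) →
      (8 : ℤ) ∣ (-1) ^ ((2 * m + 1) * (2 * m + 1 - 1) / 2) *
        ((2 * m + 1 : ℕ) : ℤ) ^ (2 * m + 1) - (1 + 4 * c) := by
    intro c hc
    rw [h₁, pow_add, pow_mul, neg_one_sq, one_pow, one_mul]
    obtain ⟨a, ha⟩ := hc
    obtain ⟨b, hb⟩ := (h₂.mul_left ((-1) ^ m)).symm.dvd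
    exact ⟨a + b, by linear_combination ha + hb⟩
  rcases Nat.even_or_odd m with hm | hm
  · obtain ⟨q, rfl⟩ := hm
    refine ⟨q, h₃ q ?_, ?_⟩
    · rw [← two_mul, pow_mul, neg_one_sq, one_pow]
      push_cast
      exact ⟨0, by ring⟩
    · rw [Int.even_iff]
      omega
  · obtain ⟨q, rfl⟩ := hm
    refine ⟨-q - 1, h₃ _ ?_, ?_⟩
    · rw [pow_succ, pow_mul, neg_one_sq, one_pow]
      push_cast
      exact ⟨0, by ring⟩
    · rw [Int.even_iff]
      omega

/-- **Swan's theorem**: the parity of the Frobenius permutation on the roots of a trinomial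
`X ^ n + X ^ k + 1` over `GF(2)` with `n` and `k` odd, when `n - k` does not divide `2 n`. -/
theorem exists_frobenius_perm_trinomial {n k : ℕ} (hn : Odd n) (hk : Odd k) (hkn : k < n)
    (hdvd : ¬ (n - k) ∣ 2 * n) :
    ∃ (F : Type) (_ : Field F) (_ : Finite F) (_ : Algebra (ZMod 2) F) (y : Fin n → F)
      (π : Equiv.Perm (Fin n)), Function.Injective y ∧
      (X ^ n + X ^ k + 1 : (ZMod 2)[X]).map (algebraMap (ZMod 2) F) = ∏ i, (X - C (y i)) ∧
      (∀ i, y (π i) = y i ^ 2) ∧ (Equiv.Perm.sign π = 1 ↔ n % 8 = 1 ∨ n % 8 = 7) := by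
  have hdeg : (X ^ n + X ^ k + 1 : ℤ[X]).natDegree = n := by
    compute_degree
    · rw [if_neg (by omega), if_neg (by omega)]
      norm_num
    all_goals omega
  have hmon : (X ^ n + X ^ k + 1 : ℤ[X]).Monic := by
    rw [Monic, leadingCoeff, hdeg]
    simp only [coeff_add, coeff_X_pow, coeff_one]
    rw [if_pos trivial, if_neg (by omega : n ≠ k), if_neg (by omega), add_zero, add_zero]
  obtain ⟨O, _, _, _, _, F, _, _, _, φ, σ, y, hφ, hy⟩ := exists_frobenius_lift _ hmon hdeg
  have hpoly : (X ^ n + X ^ k + 1 : O[X]) = ∏ i, (X - C (y i)) := by simpa using hy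
  let _ : Algebra (ZMod 2) F := ZMod.algebra F 2
  have hmap : (X ^ n + X ^ k + 1 : F[X]) = ∏ i, (X - C (φ (y i))) := by
    simpa [Polynomial.map_prod] using congrArg (Polynomial.map φ) hpoly
  -- In characteristic 2, `n = 1` and `n - k = 0`, so the discriminant is `±1` and the roots stay
  -- distinct after reduction.
  have hinj : Function.Injective fun i ↦ φ (y i) := by
    have hne : (Matrix.vandermonde fun i ↦ φ (y i)).det ≠ 0 := by
      have hsq := det_vandermonde_sq fun i ↦ φ (y i)
      rw [← hmap, prod_derivative_trinomial hk.pos hkn hn _ hmap] at hsq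
      intro h
      have h₀ : ((n - k : ℕ) : F) = 0 :=
        (CharP.cast_eq_zero_iff F 2 _).2 (Nat.Odd.sub_odd hn hk).two_dvd
      have h₁ : ((n : ℕ) : F) = 1 := by
        obtain ⟨m, rfl⟩ := hn
        push_cast
        rw [CharTwo.two_eq_zero]
        ring
      rw [h, h₀, h₁] at hsq
      simp only [zero_mul, add_zero, Finset.prod_const_one, mul_one] at hsq
      simp [eq_comm (a := (0 : F))] at hsq
    exact Matrix.det_vandermonde_ne_zero_iff.1 hne
  have hroot : ∀ i, ∃ j, y j = σ (y i) := fun i ↦ by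
    have h := congrArg (eval (y i)) hpoly
    rw [eval_prod, Finset.prod_eq_zero (Finset.mem_univ i) (by simp)] at h
    have h' := congrArg (eval (σ (y i))) hpoly
    have h'' := congrArg σ h
    simp only [eval_add, eval_pow, eval_X, eval_one, map_add, map_pow, map_one, map_zero] at h''
    simp only [eval_add, eval_pow, eval_X, eval_one, h'', eval_prod, eval_sub, eval_C] at h'
    obtain ⟨j, -, hj⟩ := Finset.prod_eq_zero_iff.1 h'.symm
    exact ⟨j, (sub_eq_zero.1 hj).symm⟩
  choose p hp using hroot
  have hpφ : ∀ i, φ (y (p i)) = φ (y i) ^ 2 := fun i ↦ by rw [hp, hφ]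
  have hpinj : Function.Injective p := fun i j hij ↦ by
    refine hinj ((frobenius_inj F 2) ?_)
    simp only [frobenius_def, ← hpφ, hij]
  let π : Equiv.Perm (Fin n) := Equiv.ofBijective p (Finite.injective_iff_bijective.1 hpinj)
  refine ⟨F, inferInstance, inferInstance, inferInstance, fun i ↦ φ (y i), π, hinj, ?_, hpφ, ?_⟩
  · simpa using hmap
  · obtain ⟨c, hc, hc'⟩ := eight_dvd_neg_one_pow_mul_pow_sub hn
    rw [← hc']
    refine frobenius_sign_eq_one_iff φ σ hφ (Matrix.vandermonde y).det c ?_ _ ?_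
    · have h := eight_dvd_det_vandermonde_sq_sub hk hkn hn hdvd y hpoly
      have h' := map_dvd (Int.castRingHom O) hc
      simp only [map_sub, map_mul, map_pow, map_add, map_neg, map_one, map_ofNat, map_natCast,
        eq_intCast] at h'
      convert dvd_add h h' using 1
      ring
    -- Applying `σ` permutes the rows of the Vandermonde matrix by `π`.
    · rw [RingHom.map_det, ← Matrix.det_permute]
      congr 1
      ext i j
      simp [Matrix.vandermonde, π, hp]

/-! ### The sign of Frobenius in terms of irreducible factors. -/

theorem dvd_of_irreducible_of_aeval_eq_zero {K F : Type*} [Field K] [Field F] [Algebra K F]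
    {P f : K[X]} (hP : Irreducible P) {a : F} (ha : aeval a P = 0) (hf : aeval a f = 0) : P ∣ f :=
  (Dvd.intro _ (minpoly.eq_of_irreducible hP ha)).trans (minpoly.dvd K a hf)

theorem pow_two_pow_natDegree_eq_self {F : Type*} [Field F] [Algebra (ZMod 2) F]
    {P : (ZMod 2)[X]} (hP : Irreducible P) {a : F} (ha : aeval a P = 0) :
    a ^ 2 ^ P.natDegree = a := by
  have h := hP.natDegree_dvd_iff_dvd_X_pow_card_pow_sub_X.1 (dvd_refl P.natDegree)
  have := aeval_eq_zero_of_dvd_aeval_eq_zero h ha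
  simpa [sub_eq_zero] using this

/-- The roots are conjugate, and every automorphism of a finite field is a power of Frobenius. This
makes Frobenius a single cycle on the roots of `Q`. -/
theorem exists_pow_two_pow_eq {F : Type*} [Field F] [Finite F] [Algebra (ZMod 2) F]
    {Q : (ZMod 2)[X]} (hQ : Irreducible Q) {a b : F} (ha : aeval a Q = 0) (hb : aeval b Q = 0) :
    ∃ m : ℕ, b = a ^ 2 ^ m := by
  have hconj : IsConjRoot (ZMod 2) b a := by
    rw [IsConjRoot, ← minpoly.eq_of_irreducible hQ ha, ← minpoly.eq_of_irreducible hQ hb]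
  obtain ⟨τ, hτ⟩ := isConjRoot_iff_exists_algEquiv.1 hconj
  obtain ⟨m, hm⟩ := FiniteField.exists_forall_apply_eq_pow (ZMod 2) 2 F τ
  exact ⟨m, by rw [← hτ, hm, Nat.card_zmod]⟩

/-- A divisor of a product of distinct linear factors has as many of their roots as its degree. -/
theorem card_filter_isRoot_eq_natDegree {F : Type*} [Field F] [DecidableEq F] {n : ℕ}
    {y : Fin n → F} (hy : Function.Injective y) {q : F[X]} (hq : q ∣ ∏ i, (X - C (y i))) :
    (Finset.univ.filter fun i ↦ q.IsRoot (y i)).card = q.natDegree := by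
  have hne : ∏ i, (X - C (y i)) ≠ 0 := Finset.prod_ne_zero_iff.2 fun i _ ↦ X_sub_C_ne_zero _
  have hroots : (∏ i, (X - C (y i))).roots = Finset.univ.val.map y := by
    rw [← roots_multiset_prod_X_sub_C (Finset.univ.val.map y), Multiset.map_map]
    rfl
  have hle := roots.le_of_dvd hne hq
  have hsplit : q.Splits :=
    Splits.of_dvd (Splits.prod fun i _ ↦ Splits.X_sub_C _) hne hq
  have hnodup : q.roots.Nodup := by
    refine Multiset.nodup_of_le hle ?_
    rw [hroots]
    exact Finset.univ.nodup.map hy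
  have himage : (Finset.univ.filter fun i ↦ q.IsRoot (y i)).image y = q.roots.toFinset := by
    ext a
    simp only [Finset.mem_image, Finset.mem_filter, Finset.mem_univ, true_and,
      Multiset.mem_toFinset, mem_roots (ne_zero_of_dvd_ne_zero hne hq)]
    constructor
    · rintro ⟨i, hi, rfl⟩
      exact hi
    · intro ha
      have h := Multiset.mem_of_le hle ((mem_roots (ne_zero_of_dvd_ne_zero hne hq)).2 ha)
      rw [hroots, Multiset.mem_map] at h
      obtain ⟨i, -, rfl⟩ := h
      exact ⟨i, ha, rfl⟩
  rw [← Finset.card_image_of_injective _ hy, himage, Multiset.toFinset_card_of_nodup hnodup,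
    hsplit.natDegree_eq_card_roots]

section FrobeniusPerm

variable {F : Type*} [Field F] {n : ℕ} {y : Fin n → F} {π : Equiv.Perm (Fin n)}

theorem apply_perm_pow (hπ : ∀ i, y (π i) = y i ^ 2) (m : ℕ) (i : Fin n) :
    y ((π ^ m) i) = y i ^ 2 ^ m := by
  induction m with
  | zero => simp
  | succ m ih => rw [pow_succ', Equiv.Perm.mul_apply, hπ, ih, ← pow_mul, ← pow_succ]

variable [Algebra (ZMod 2) F]

theorem aeval_eq_zero_of_map_eq_prod {T : (ZMod 2)[X]}
    (hT : T.map (algebraMap (ZMod 2) F) = ∏ i, (X - C (y i))) (i : Fin n) : aeval (y i) T = 0 := by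
  rw [aeval_def, ← eval_map, hT, eval_prod, Finset.prod_eq_zero (Finset.mem_univ i) (by simp)]

/-- The `n`-th power of `π` is trivial and `n` is odd, so the sign cannot be `-1`. -/
theorem sign_frobenius_of_irreducible {T : (ZMod 2)[X]} (hT : Irreducible T) (hn : Odd n)
    (hdeg : T.natDegree = n) (hy : Function.Injective y)
    (hTy : T.map (algebraMap (ZMod 2) F) = ∏ i, (X - C (y i)))
    (hπ : ∀ i, y (π i) = y i ^ 2) : Equiv.Perm.sign π = 1 := by
  have h : π ^ n = 1 := by
    ext i : 1
    refine hy ?_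
    have := pow_two_pow_natDegree_eq_self hT (aeval_eq_zero_of_map_eq_prod hTy i)
    rwa [hdeg, ← apply_perm_pow hπ] at this
  have h' := congrArg Equiv.Perm.sign h
  rw [map_pow, map_one] at h'
  rcases Int.units_eq_one_or (Equiv.Perm.sign π) with h₁ | h₁
  · exact h₁
  · rw [h₁, hn.neg_one_pow] at h'
    exact absurd h' (by decide)

/-- If a product of an irreducible polynomial of odd degree `r` and an irreducible polynomial of
even degree `d` has distinct roots, the Frobenius acts on them as an odd permutation. -/
theorem sign_frobenius_of_mul [Finite F] {P Q : (ZMod 2)[X]} (hP : Irreducible P)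
    (hQ : Irreducible Q) (hd : Even Q.natDegree)
    (hrd : P.natDegree * P.natDegree % Q.natDegree = 1) (hy : Function.Injective y)
    (hTy : (P * Q).map (algebraMap (ZMod 2) F) = ∏ i, (X - C (y i)))
    (hπ : ∀ i, y (π i) = y i ^ 2) : Equiv.Perm.sign π = -1 := by
  classical
  set r := P.natDegree with hr'
  set d := Q.natDegree with hd'
  have hd₂ : 2 ≤ d := by
    have := hQ.natDegree_pos
    obtain ⟨e, he⟩ := hd
    omega
  have hcases : ∀ i, aeval (y i) P = 0 ∨ aeval (y i) Q = 0 := fun i ↦ by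
    have := aeval_eq_zero_of_map_eq_prod hTy i
    rwa [map_mul, mul_eq_zero] at this
  have hPfix : ∀ i, aeval (y i) P = 0 → (π ^ r) i = i := fun i hi ↦ hy <| by
    rw [apply_perm_pow hπ, pow_two_pow_natDegree_eq_self hP hi]
  have hQfix : ∀ i, aeval (y i) Q = 0 → (π ^ d) i = i := fun i hi ↦ hy <| by
    rw [apply_perm_pow hπ, pow_two_pow_natDegree_eq_self hQ hi]
  have hQne : ∀ i, aeval (y i) Q = 0 → π i ≠ i := fun i hi h ↦ by
    have h₂ : y i ^ 2 = y i := by rw [← hπ, h]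
    have hdvd : Q ∣ X ^ Nat.card (ZMod 2) ^ 1 - X := by
      refine dvd_of_irreducible_of_aeval_eq_zero hQ hi ?_
      simp [h₂]
    have := Nat.le_of_dvd one_pos (hQ.natDegree_dvd_of_dvd_X_pow_card_pow_sub_X hdvd)
    omega
  -- The exponent is a multiple of `r` and is 1 modulo `d`: `g` fixes the roots of `P` and acts as
  -- `π` on those of `Q`, so it is a `d`-cycle.
  set g := π ^ (r * r) with hg
  have hgP : ∀ i, aeval (y i) P = 0 → g i = i := fun i hi ↦ by
    rw [hg, pow_mul]
    exact Equiv.Perm.pow_apply_eq_self_of_apply_eq_self (hPfix i hi) r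
  have hgQ : ∀ i, aeval (y i) Q = 0 → g i = π i := fun i hi ↦ by
    rw [hg, ← Nat.div_add_mod (r * r) d, hrd, pow_succ', Equiv.Perm.mul_apply, pow_mul]
    congr 1
    exact Equiv.Perm.pow_apply_eq_self_of_apply_eq_self (hQfix i hi) _
  have hsupp : g.support = Finset.univ.filter fun i ↦ aeval (y i) Q = 0 := by
    ext i
    simp only [Equiv.Perm.mem_support, Finset.mem_filter, Finset.mem_univ, true_and]
    refine ⟨fun h ↦ (hcases i).resolve_left fun hi ↦ h (hgP i hi), fun hi ↦ ?_⟩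
    rw [hgQ i hi]
    exact hQne i hi
  have hcard : g.support.card = d := by
    have hdvd : Q.map (algebraMap (ZMod 2) F) ∣ ∏ i, (X - C (y i)) := by
      rw [← hTy, Polynomial.map_mul]
      exact dvd_mul_left _ _
    have h := card_filter_isRoot_eq_natDegree hy hdvd
    simp only [IsRoot, eval_map_algebraMap, natDegree_map] at h
    rw [hsupp, h]
  have hQπ : ∀ i, aeval (y i) Q = 0 → aeval (y (π i)) Q = 0 := fun i hi ↦ by
    rw [hπ, ← expand_aeval, ZMod.expand_card, map_pow, hi, zero_pow two_ne_zero]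
  have hgpow : ∀ m i, aeval (y i) Q = 0 → aeval (y ((π ^ m) i)) Q = 0 ∧
      (g ^ m) i = (π ^ m) i := by
    intro m i hi
    induction m with
    | zero => simpa
    | succ m ih =>
      rw [pow_succ', pow_succ', Equiv.Perm.mul_apply, Equiv.Perm.mul_apply, ih.2, hgQ _ ih.1]
      exact ⟨hQπ _ ih.1, rfl⟩
  have hcycle : g.IsCycle := by
    obtain ⟨i, hi⟩ : g.support.Nonempty := by
      rw [← Finset.card_pos]
      omega
    rw [hsupp, Finset.mem_filter] at hi
    refine ⟨i, by rw [hgQ i hi.2]; exact hQne i hi.2, fun j hj ↦ ?_⟩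
    rw [← Equiv.Perm.mem_support, hsupp, Finset.mem_filter] at hj
    obtain ⟨m, hm⟩ := exists_pow_two_pow_eq hQ hi.2 hj.2
    refine ⟨m, ?_⟩
    rw [zpow_natCast, (hgpow m i hi.2).2]
    exact hy (by rw [apply_perm_pow hπ, hm])
  have hsign := hcycle.sign
  rw [hcard, hd.neg_one_pow, hg, map_pow] at hsign
  rcases Int.units_eq_one_or (Equiv.Perm.sign π) with h₁ | h₁
  · rw [h₁, one_pow] at hsign
    exact absurd hsign (by decide)
  · exact h₁

end FrobeniusPerm

/-! ### Reciprocal polynomials and small factors of trinomials. -/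

theorem irreducible_mirror {R : Type*} [CommRing R] [IsDomain R] {P : R[X]}
    (hP : Irreducible P) : Irreducible P.mirror := by
  have hunit : ∀ f : R[X], IsUnit f → IsUnit f.mirror := fun f hf ↦ by
    obtain ⟨c, hc, rfl⟩ := isUnit_iff.1 hf
    rwa [mirror_C]
  refine ⟨fun h ↦ hP.not_isUnit (P.mirror_mirror ▸ hunit _ h), fun a b hab ↦ ?_⟩
  have h := hP.isUnit_or_isUnit (a := a.mirror) (b := b.mirror) (by
    rw [← mirror_mul_of_domain, ← hab, mirror_mirror])
  exact h.imp (fun h ↦ a.mirror_mirror ▸ hunit _ h) fun h ↦ b.mirror_mirror ▸ hunit _ h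

theorem mirror_X_pow_add_X_pow_add_one {n s : ℕ} (hs : 0 < s) (hsn : s < n) :
    (X ^ n + X ^ s + 1 : (ZMod 2)[X]).mirror = X ^ n + X ^ (n - s) + 1 := by
  have h := trinomial_mirror (R := ZMod 2) (v := 1) hs hsn one_ne_zero one_ne_zero
  simp only [trinomial_def, C_1, one_mul, pow_zero, add_zero] at h
  rw [show (X ^ n + X ^ s + 1 : (ZMod 2)[X]) = 1 + X ^ s + X ^ n by ring, h]
  ring

theorem natDegree_X_pow_add_X_pow_add_one {n k : ℕ} (hkn : k < n) :
    (X ^ n + X ^ k + 1 : (ZMod 2)[X]).natDegree = n := by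
  compute_degree
  · rw [if_neg (by omega), if_neg (by omega)]
    norm_num
  all_goals omega

theorem zmod_two_eq_one {c : ZMod 2} (hc : c ≠ 0) : c = 1 := by
  revert c
  decide

theorem eval_ne_zero_of_dvd_trinomial {n k : ℕ} (hk : 0 < k) (hkn : k < n) {Q : (ZMod 2)[X]}
    (hQ : Q ∣ X ^ n + X ^ k + 1) (c : ZMod 2) : Q.eval c ≠ 0 := by
  intro h
  have h' := eval_eq_zero_of_dvd_of_eval_eq_zero hQ h
  simp only [eval_add, eval_pow, eval_X, eval_one] at h'
  rcases eq_or_ne c 0 with rfl | hc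
  · simp [hk.ne', (hk.trans hkn).ne'] at h'
  · rw [zmod_two_eq_one hc, one_pow, one_pow] at h'
    exact absurd h' (by decide)

theorem natDegree_ne_one_of_eval_ne_zero {Q : (ZMod 2)[X]} (hQ : ∀ c, Q.eval c ≠ 0) :
    Q.natDegree ≠ 1 := fun h ↦ by
  obtain ⟨c, hc⟩ := exists_root_of_degree_eq_one ((degree_eq_iff_natDegree_eq_of_pos one_pos).2 h)
  exact hQ c hc

theorem eq_of_natDegree_eq_two {Q : (ZMod 2)[X]} (hQ : ∀ c, Q.eval c ≠ 0)
    (hdeg : Q.natDegree = 2) : Q = X ^ 2 + X + 1 := by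
  have h₂ : Q.coeff 2 = 1 := by
    refine zmod_two_eq_one ?_
    have h : Q.leadingCoeff ≠ 0 := leadingCoeff_ne_zero.2 (by rintro rfl; simp at hdeg)
    rwa [leadingCoeff, hdeg] at h
  have h₀ : Q.coeff 0 = 1 := zmod_two_eq_one (by simpa [coeff_zero_eq_eval_zero] using hQ 0)
  have h₁ : Q.coeff 1 = 1 := by
    have h := hQ 1
    rw [eval_eq_sum_range, hdeg] at h
    simp only [Finset.sum_range_succ, Finset.sum_range_zero, h₀, h₂] at h
    revert h
    generalize Q.coeff 1 = c
    revert c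
    decide
  rw [Q.as_sum_range_C_mul_X_pow, hdeg]
  simp only [Finset.sum_range_succ, Finset.sum_range_zero, h₀, h₁, h₂, C_1]
  ring

theorem natDegree_X_sq_add_X_add_one : (X ^ 2 + X + 1 : (ZMod 2)[X]).natDegree = 2 := by
  compute_degree!

theorem irreducible_X_sq_add_X_add_one : Irreducible (X ^ 2 + X + 1 : (ZMod 2)[X]) := by
  have h0 : (X ^ 2 + X + 1 : (ZMod 2)[X]) ≠ 0 := by
    intro h
    have := natDegree_X_sq_add_X_add_one
    rw [h] at this
    simp at this
  rw [irreducible_iff_roots_eq_zero_of_degree_le_three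
    (by rw [natDegree_X_sq_add_X_add_one]) (by rw [natDegree_X_sq_add_X_add_one]; norm_num),
    Multiset.eq_zero_iff_forall_notMem]
  intro c hc
  rw [mem_roots h0, IsRoot] at hc
  simp only [eval_add, eval_pow, eval_X, eval_one] at hc
  revert c
  decide

section Root

variable {F : Type*} [Field F]

theorem two_eq_zero_of_algebra_zmod_two [Algebra (ZMod 2) F] : (2 : F) = 0 := by
  rw [← map_ofNat (algebraMap (ZMod 2) F) 2, show (OfNat.ofNat 2 : ZMod 2) = 0 from rfl, map_zero]

theorem ne_zero_of_trinomial_eq_zero {n k : ℕ} (hk : 0 < k) (hkn : k < n) {a : F}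
    (h : a ^ n + a ^ k + 1 = 0) : a ≠ 0 := by
  rintro rfl
  simp [hk.ne', (hk.trans hkn).ne'] at h

theorem pow_eq_one_of_irreducible [Algebra (ZMod 2) F] {P : (ZMod 2)[X]} (hP : Irreducible P) {a : F}
    (ha₀ : a ≠ 0) (ha : aeval a P = 0) {m : ℕ} (hm : 2 ^ P.natDegree = m + 1) : a ^ m = 1 := by
  have h := pow_two_pow_natDegree_eq_self hP ha
  rw [hm, pow_succ] at h
  exact (mul_eq_right₀ ha₀).1 h

theorem pow_three_eq_one {a : F} (ha : a ^ 2 + a + 1 = 0) : a ^ 3 = 1 := by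
  linear_combination (a - 1) * ha

end Root

theorem exists_root_of_dvd_trinomial {n k : ℕ} {P : (ZMod 2)[X]} (hdeg : P.natDegree ≠ 0)
    (hP : P ∣ X ^ n + X ^ k + 1) :
    ∃ a : AlgebraicClosure (ZMod 2), aeval a P = 0 ∧ a ^ n + a ^ k + 1 = 0 := by
  obtain ⟨a, ha⟩ := IsAlgClosed.exists_aeval_eq_zero (AlgebraicClosure (ZMod 2)) P
    (fun h ↦ hdeg (natDegree_eq_of_degree_eq_some h))
  exact ⟨a, ha, by simpa using aeval_eq_zero_of_dvd_aeval_eq_zero hP ha⟩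

/-- `X ^ 2 + X + 1` divides `X ^ n + X ^ k + 1` only if `{n, k} ≡ {1, 2}` modulo `3`. -/
theorem X_sq_add_X_add_one_dvd_trinomial_iff {n k : ℕ} :
    (X ^ 2 + X + 1 : (ZMod 2)[X]) ∣ X ^ n + X ^ k + 1 ↔
      (n % 3 = 1 ∧ k % 3 = 2) ∨ (n % 3 = 2 ∧ k % 3 = 1) := by
  have h₂ : (2 : AlgebraicClosure (ZMod 2)) = 0 := two_eq_zero_of_algebra_zmod_two
  obtain ⟨a, ha, -⟩ := exists_root_of_dvd_trinomial (n := 2) (k := 1)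
    (P := X ^ 2 + X + 1) (by rw [natDegree_X_sq_add_X_add_one]; norm_num) (by rw [pow_one])
  have ha' : a ^ 2 + a + 1 = 0 := by simpa using ha
  have ha₀ : a ≠ 0 := by
    rintro rfl
    simp at ha'
  have ha₁ : a ≠ 1 := by
    rintro rfl
    exact one_ne_zero (α := AlgebraicClosure (ZMod 2)) (by linear_combination ha' - h₂)
  have h₃ := pow_three_eq_one ha'
  have hiff : (X ^ 2 + X + 1 : (ZMod 2)[X]) ∣ X ^ n + X ^ k + 1 ↔
      a ^ (n % 3) + a ^ (k % 3) + 1 = 0 := by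
    rw [← pow_eq_pow_mod n h₃, ← pow_eq_pow_mod k h₃]
    constructor
    · intro h
      simpa using aeval_eq_zero_of_dvd_aeval_eq_zero h ha
    · intro h
      exact dvd_of_irreducible_of_aeval_eq_zero irreducible_X_sq_add_X_add_one ha (by simpa using h)
  rw [hiff]
  have hn := Nat.mod_lt n three_pos
  have hk := Nat.mod_lt k three_pos
  generalize n % 3 = r at *
  generalize k % 3 = t at *
  have h₁₀ : (1 : AlgebraicClosure (ZMod 2)) ≠ 0 := one_ne_zero
  have hsq := pow_ne_zero 2 ha₀
  interval_cases r <;> interval_cases t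
  · exact iff_of_false (fun h ↦ h₁₀ (by linear_combination h - h₂)) (by norm_num)
  · exact iff_of_false (fun h ↦ ha₀ (by linear_combination h - h₂)) (by norm_num)
  · exact iff_of_false (fun h ↦ hsq (by linear_combination h - h₂)) (by norm_num)
  · exact iff_of_false (fun h ↦ ha₀ (by linear_combination h - h₂)) (by norm_num)
  · exact iff_of_false (fun h ↦ h₁₀ (by linear_combination h - a * h₂)) (by norm_num)
  · exact iff_of_true (by linear_combination ha') (by norm_num)
  · exact iff_of_false (fun h ↦ hsq (by linear_combination h - h₂)) (by norm_num)
  · exact iff_of_true (by linear_combination ha') (by norm_num)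
  · exact iff_of_false (fun h ↦ h₁₀ (by linear_combination h - a ^ 2 * h₂)) (by norm_num)

theorem separable_trinomial {n k : ℕ} (hn : Odd n) (hk : Odd k) :
    (X ^ n + X ^ k + 1 : (ZMod 2)[X]).Separable := by
  have hcast : ∀ m : ℕ, Odd m → ((m : ℕ) : (ZMod 2)[X]) = 1 := fun m hm ↦ by
    rw [← C_eq_natCast, (ZMod.natCast_eq_one_iff_odd).2 hm, C_1]
  -- In characteristic 2 with `n` and `k` odd, `X f' = X^n + X^k`, hence `f - X f' = 1`.
  refine ⟨1, -X, ?_⟩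
  have e₁ : (X : (ZMod 2)[X]) * X ^ (n - 1) = X ^ n := by
    rw [← pow_succ', Nat.sub_add_cancel hn.pos]
  have e₂ : (X : (ZMod 2)[X]) * X ^ (k - 1) = X ^ k := by
    rw [← pow_succ', Nat.sub_add_cancel hk.pos]
  simp only [derivative_add, derivative_X_pow, derivative_one, C_eq_natCast, hcast n hn, hcast k hk]
  linear_combination -e₁ - e₂

/-- A reducible quartic without roots is `(X ^ 2 + X + 1) ^ 2`, which is not squarefree. -/
theorem irreducible_of_natDegree_eq_four {Q T : (ZMod 2)[X]} (hT : Squarefree T) (hQT : Q ∣ T)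
    (hQ : ∀ c, Q.eval c ≠ 0) (hdeg : Q.natDegree = 4) : Irreducible Q := by
  have hQ₀ : Q ≠ 0 := by
    rintro rfl
    simp at hdeg
  rw [irreducible_iff_lt_natDegree_lt hQ₀ fun h ↦ by
    rw [natDegree_eq_zero_of_isUnit h] at hdeg
    omega]
  rintro q - hq ⟨p, rfl⟩
  rw [hdeg, Finset.mem_Ioc] at hq
  have hqe : ∀ c, q.eval c ≠ 0 := fun c hc ↦ hQ c (by rw [eval_mul, hc, zero_mul])
  have hpe : ∀ c, p.eval c ≠ 0 := fun c hc ↦ hQ c (by rw [eval_mul, hc, mul_zero])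
  have hq₁ := natDegree_ne_one_of_eval_ne_zero hqe
  rw [natDegree_mul (left_ne_zero_of_mul hQ₀) (right_ne_zero_of_mul hQ₀)] at hdeg
  have h := eq_of_natDegree_eq_two hqe (by omega)
  rw [h, eq_of_natDegree_eq_two hpe (by omega)] at hQT
  exact irreducible_X_sq_add_X_add_one.not_isUnit (hT _ hQT)

theorem natDegree_eq_of_irreducible_of_dvd {K : Type*} [Field K] {A P : K[X]}
    (hA : Irreducible A) (hP : Irreducible P) (h : A ∣ P) : A.natDegree = P.natDegree :=
  natDegree_eq_of_degree_eq (degree_eq_degree_of_associated (hA.associated_of_dvd hP h))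

/-- A root `a` satisfies `a ^ 15 = 1`, and `ω = a ^ 5` is a primitive cube root of unity. The
trinomial gives `a ^ k = ω ^ 2`; raising to the fifth power gives `ω ^ k = ω`. -/
theorem mod_three_eq_one_of_quartic_dvd {n k : ℕ} (hn : n % 15 = 5) {Q : (ZMod 2)[X]}
    (hQ : Irreducible Q) (hdeg : Q.natDegree = 4) (hk : 0 < k) (hkn : k < n)
    (hdvd : Q ∣ X ^ n + X ^ k + 1) : k % 3 = 1 := by
  obtain ⟨a, haQ, ha⟩ := exists_root_of_dvd_trinomial (by rw [hdeg]; norm_num) hdvd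
  have h₂ : (2 : AlgebraicClosure (ZMod 2)) = 0 := two_eq_zero_of_algebra_zmod_two
  have ha₀ := ne_zero_of_trinomial_eq_zero hk hkn ha
  have h₁₅ : a ^ 15 = 1 := pow_eq_one_of_irreducible hQ ha₀ haQ (by rw [hdeg]; norm_num)
  rw [pow_eq_pow_mod n h₁₅, hn] at ha
  have hw₁ : a ^ 5 ≠ 1 := fun h ↦ pow_ne_zero k ha₀ (by linear_combination ha - h - h₂)
  have hw : (a ^ 5) ^ 2 + a ^ 5 + 1 = 0 :=
    (mul_eq_zero.1 (show (a ^ 5 - 1) * ((a ^ 5) ^ 2 + a ^ 5 + 1) = 0 by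
      linear_combination h₁₅)).resolve_left (sub_ne_zero.2 hw₁)
  have hak : a ^ k = (a ^ 5) ^ 2 := by linear_combination ha - hw
  have hcube := pow_three_eq_one hw
  have key : (a ^ 5) ^ (k % 3) = a ^ 5 := by
    rw [← pow_eq_pow_mod k hcube, ← pow_mul, mul_comm, pow_mul, hak, ← pow_mul,
      pow_eq_pow_mod (2 * 5) hcube, pow_one]
  have hk₃ := Nat.mod_lt k three_pos
  generalize k % 3 = r at *
  interval_cases r
  · exact absurd (by simpa using key.symm) hw₁
  · rfl
  · exact absurd (mul_left_cancel₀ (pow_ne_zero 5 ha₀) (by linear_combination key)) hw₁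

theorem not_quartic_dvd {n k : ℕ} (hn : n % 15 = 7) (hk₃ : k % 3 = 2) {Q : (ZMod 2)[X]}
    (hQ : Irreducible Q) (hdeg : Q.natDegree = 4) (hk : 0 < k) (hkn : k < n) :
    ¬ Q ∣ X ^ n + X ^ k + 1 := by
  intro hdvd
  obtain ⟨a, haQ, ha⟩ := exists_root_of_dvd_trinomial (by rw [hdeg]; norm_num) hdvd
  have h₂ : (2 : AlgebraicClosure (ZMod 2)) = 0 := two_eq_zero_of_algebra_zmod_two
  have ha₀ := ne_zero_of_trinomial_eq_zero hk hkn ha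
  have h₁₅ : a ^ 15 = 1 := pow_eq_one_of_irreducible hQ ha₀ haQ (by rw [hdeg]; norm_num)
  rw [pow_eq_pow_mod n h₁₅, hn] at ha
  have hcube : (a ^ 5) ^ 3 = 1 := by rw [← pow_mul, h₁₅]
  have h₅ : (a ^ k) ^ 5 = a ^ 10 := by
    rw [← pow_mul, mul_comm, pow_mul, pow_eq_pow_mod k hcube, hk₃, ← pow_mul]
  have hak : a ^ k = -(1 + a ^ 7) := by linear_combination ha
  rw [hak] at h₅
  -- Modulo 2, `(1 + a^7)^5 = (1 + a^28)(1 + a^7)`; exponents are then reduced modulo 15.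
  have h₁₃ : a ^ 13 + a ^ 10 + a ^ 7 + a ^ 5 + 1 = 0 := by
    linear_combination -h₅ - (2 * a ^ 7 + 5 * a ^ 14 + 5 * a ^ 21 + 2 * a ^ 28) * h₂ -
      (a ^ 13 + a ^ 5 * (a ^ 15 + 1)) * h₁₅
  -- A Bézout identity over GF(2) between the polynomial of `h₁₃` and `X ^ 15 - 1`; the multiple of
  -- `h₂` absorbs the even coefficients.
  have hω : a ^ 2 + a + 1 = 0 := by
    linear_combination (a + a ^ 4 + a ^ 6 + a ^ 8 + a ^ 11) * h₁₃ +
      (a ^ 9 + a ^ 4 + a ^ 2 + 1) * h₁₅ - (- 1 - a ^ 2 + a ^ 6 + a ^ 8 + 2 * a ^ 11 + a ^ 13 + a ^ 14 + a ^ 15 + a ^ 16 + a ^ 17 + a ^ 18 + a ^ 19 + a ^ 21 + a ^ 24) * h₂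
  have h := natDegree_eq_of_irreducible_of_dvd hQ irreducible_X_sq_add_X_add_one
    (dvd_of_irreducible_of_aeval_eq_zero hQ haQ (by simpa using hω))
  rw [hdeg, natDegree_X_sq_add_X_add_one] at h
  omega

/-- A root would satisfy `a ^ 7 = 1`, so `a ^ n = 1`, leaving `a ^ k = 0`. -/
theorem not_cubic_dvd {n k : ℕ} (hn : n % 7 = 0) {Q : (ZMod 2)[X]}
    (hQ : Irreducible Q) (hdeg : Q.natDegree = 3) (hk : 0 < k) (hkn : k < n) :
    ¬ Q ∣ X ^ n + X ^ k + 1 := by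
  intro hdvd
  obtain ⟨a, haQ, ha⟩ := exists_root_of_dvd_trinomial (by rw [hdeg]; norm_num) hdvd
  have h₂ : (2 : AlgebraicClosure (ZMod 2)) = 0 := two_eq_zero_of_algebra_zmod_two
  have ha₀ := ne_zero_of_trinomial_eq_zero hk hkn ha
  have h₇ : a ^ 7 = 1 := pow_eq_one_of_irreducible hQ ha₀ haQ (by rw [hdeg]; norm_num)
  rw [pow_eq_pow_mod n h₇, hn] at ha
  exact pow_ne_zero k ha₀ (by linear_combination ha - h₂)

/-! ### Excluding the increments 0, 4 and 6, and the conclusion. -/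

theorem sub_dvd_two_mul_of_irreducible {n k : ℕ} (hn : Odd n) (hk : Odd k) (hkn : k < n)
    (hT : Irreducible (X ^ n + X ^ k + 1 : (ZMod 2)[X])) (hn₈ : n % 8 = 3 ∨ n % 8 = 5) :
    (n - k) ∣ 2 * n := by
  by_contra h
  obtain ⟨F, _, _, _, y, π, hy, hTy, hπ, hsign⟩ := exists_frobenius_perm_trinomial hn hk hkn h
  have := hsign.1 (sign_frobenius_of_irreducible hT hn (natDegree_X_pow_add_X_pow_add_one hkn)
    hy hTy hπ)
  omega

theorem sub_dvd_two_mul_of_eq_mul {n k : ℕ} (hn : Odd n) (hk : Odd k) (hkn : k < n)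
    {P Q : (ZMod 2)[X]} (hT : X ^ n + X ^ k + 1 = P * Q) (hP : Irreducible P)
    (hQ : Irreducible Q) (hd : Even Q.natDegree)
    (hrd : P.natDegree * P.natDegree % Q.natDegree = 1) (hn₈ : n % 8 = 1 ∨ n % 8 = 7) :
    (n - k) ∣ 2 * n := by
  by_contra h
  obtain ⟨F, _, _, _, y, π, hy, hTy, hπ, hsign⟩ := exists_frobenius_perm_trinomial hn hk hkn h
  rw [hT] at hTy
  have := hsign.2 hn₈
  rw [sign_frobenius_of_mul hP hQ hd hrd hy hTy hπ] at this
  exact absurd this (by decide)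

section Mersenne

variable {n k : ℕ} {P Q : (ZMod 2)[X]}

theorem not_X_sq_add_X_add_one_dvd_mul (hP : Irreducible P) (hPdeg : P.natDegree = 216091)
    (hQ : Irreducible Q) (hQdeg : Q.natDegree ≠ 2) : ¬ X ^ 2 + X + 1 ∣ P * Q := by
  intro h
  rcases irreducible_X_sq_add_X_add_one.prime.dvd_or_dvd h with h | h
  · have := natDegree_eq_of_irreducible_of_dvd irreducible_X_sq_add_X_add_one hP h
    rw [natDegree_X_sq_add_X_add_one, hPdeg] at this
    omega
  · have := natDegree_eq_of_irreducible_of_dvd irreducible_X_sq_add_X_add_one hQ h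
    rw [natDegree_X_sq_add_X_add_one] at this
    exact hQdeg this.symm

theorem not_irreducible_trinomial_of_odd (hk : Odd k) (hkn : k < n) (hn : n = 216091) :
    ¬ Irreducible (X ^ n + X ^ k + 1 : (ZMod 2)[X]) := by
  intro hT
  have hn_odd : Odd n := by rw [Nat.odd_iff]; omega
  have hdvd := sub_dvd_two_mul_of_irreducible hn_odd hk hkn hT (by omega)
  obtain ⟨d, hd⟩ := (Nat.Odd.sub_odd hn_odd hk).two_dvd
  rw [hd] at hdvd
  have hdn : d ∣ 216091 := hn ▸ Nat.dvd_of_mul_dvd_mul_left two_pos hdvd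
  have hp : Nat.Prime 216091 := by norm_num
  -- The other divisor, `d = n`, would give `n - k = 2n`. With `d = 1`, `k = n - 2`, so `n ≡ 1` and
  -- `k ≡ 2` modulo 3.
  have hd₁ : d = 1 := by
    rcases (Nat.dvd_prime hp).1 hdn with h | h
    · exact h
    · have := hk.pos
      omega
  have hA : (X ^ 2 + X + 1 : (ZMod 2)[X]) ∣ X ^ n + X ^ k + 1 :=
    X_sq_add_X_add_one_dvd_trinomial_iff.2 (by omega)
  have h := natDegree_eq_of_irreducible_of_dvd irreducible_X_sq_add_X_add_one hT hA
  rw [natDegree_X_sq_add_X_add_one, natDegree_X_pow_add_X_pow_add_one hkn] at h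
  omega

theorem natDegree_cofactor_ne_four (hk : Odd k) (hkn : k < n) (hn : n = 216095)
    (hP : Irreducible P) (hPdeg : P.natDegree = 216091) (hT : X ^ n + X ^ k + 1 = P * Q) :
    Q.natDegree ≠ 4 := by
  intro hQdeg
  have hn_odd : Odd n := by rw [Nat.odd_iff]; omega
  have hQT : Q ∣ X ^ n + X ^ k + 1 := hT ▸ dvd_mul_left Q P
  have hQ := irreducible_of_natDegree_eq_four (separable_trinomial hn_odd hk).squarefree hQT
    (eval_ne_zero_of_dvd_trinomial hk.pos hkn hQT) hQdeg
  have hk₃ := mod_three_eq_one_of_quartic_dvd (by omega) hQ hQdeg hk.pos hkn hQT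
  refine not_X_sq_add_X_add_one_dvd_mul hP hPdeg hQ (by omega) ?_
  rw [← hT]
  exact X_sq_add_X_add_one_dvd_trinomial_iff.2 (by omega)

/-- A proper factorization has a factor of degree 2 or 3. Degree 3 fails because 7 divides `n`;
degree 2 forces `k ≡ 2` modulo 3 and leaves an irreducible quartic, impossible as `n ≡ 7` modulo 15.
-/
theorem irreducible_cofactor_of_natDegree_eq_six (hk : Odd k) (hkn : k < n) (hn : n = 216097)
    (hQT : Q ∣ X ^ n + X ^ k + 1) (hQdeg : Q.natDegree = 6) : Irreducible Q := by
  have hn_odd : Odd n := by rw [Nat.odd_iff]; omega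
  have hsq := (separable_trinomial hn_odd hk).squarefree
  have hQ₀ : Q ≠ 0 := by
    rintro rfl
    simp at hQdeg
  rw [irreducible_iff_lt_natDegree_lt hQ₀ fun h ↦ by
    rw [natDegree_eq_zero_of_isUnit h] at hQdeg
    omega]
  rintro q - hq ⟨p, rfl⟩
  rw [hQdeg, Finset.mem_Ioc] at hq
  have hqT := (dvd_mul_right q p).trans hQT
  have hpT := (dvd_mul_left p q).trans hQT
  have hqe := eval_ne_zero_of_dvd_trinomial hk.pos hkn hqT
  have hpe := eval_ne_zero_of_dvd_trinomial hk.pos hkn hpT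
  have hq₁ := natDegree_ne_one_of_eval_ne_zero hqe
  rw [natDegree_mul (left_ne_zero_of_mul hQ₀) (right_ne_zero_of_mul hQ₀)] at hQdeg
  rcases (by omega : q.natDegree = 2 ∨ q.natDegree = 3) with h | h
  · rw [eq_of_natDegree_eq_two hqe h, X_sq_add_X_add_one_dvd_trinomial_iff] at hqT
    have hp₄ : p.natDegree = 4 := by omega
    exact not_quartic_dvd (by omega) (by omega)
      (irreducible_of_natDegree_eq_four hsq hpT hpe hp₄) hp₄ hk.pos hkn hpT
  · have hqi : Irreducible q := by
      have hq₀ := left_ne_zero_of_mul hQ₀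
      rw [irreducible_iff_roots_eq_zero_of_degree_le_three (by omega) (by omega),
        Multiset.eq_zero_iff_forall_notMem]
      intro c hc
      exact hqe c (mem_roots hq₀ |>.1 hc)
    exact not_cubic_dvd (by omega) hqi h hk.pos hkn hqT

theorem natDegree_cofactor_ne_six (hk : Odd k) (hkn : k < n) (hn : n = 216097)
    (hP : Irreducible P) (hPdeg : P.natDegree = 216091) (hT : X ^ n + X ^ k + 1 = P * Q) :
    Q.natDegree ≠ 6 := by
  intro hQdeg
  have hn_odd : Odd n := by rw [Nat.odd_iff]; omega
  have hQ := irreducible_cofactor_of_natDegree_eq_six hk hkn hn (hT ▸ dvd_mul_left Q P) hQdeg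
  have hdvd := sub_dvd_two_mul_of_eq_mul hn_odd hk hkn hT hP hQ (by rw [hQdeg]; decide)
    (by rw [hQdeg, hPdeg]) (by omega)
  obtain ⟨d, hd⟩ := (Nat.Odd.sub_odd hn_odd hk).two_dvd
  rw [hd] at hdvd
  have hdn := Nat.dvd_of_mul_dvd_mul_left two_pos hdvd
  rw [hn, show 216097 = 7 * 30871 by norm_num] at hdn
  -- Both primes 7 and 30871 are 1 modulo 3, hence so is every divisor; then `k = n - 2d ≡ 2` modulo
  -- 3.
  have hd₃ : d % 3 = 1 := by
    obtain ⟨u, v, hu, hv, rfl⟩ := Nat.dvd_mul.1 hdn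
    rcases (Nat.dvd_prime (by norm_num)).1 hu with rfl | rfl <;>
      rcases (Nat.dvd_prime (by norm_num)).1 hv with rfl | rfl <;> rfl
  refine not_X_sq_add_X_add_one_dvd_mul hP hPdeg hQ (by omega) ?_
  rw [← hT]
  exact X_sq_add_X_add_one_dvd_trinomial_iff.2 (by omega)

end Mersenne

theorem theorem6p1 (T : (ZMod 2)[X]) (δ : ℕ) (hT : IsTrinomial T)
    (h : IsAlmostIrreducible T 216091 δ) :
    δ ∉ ({0, 1, 2, 4, 6} : Set ℕ) := by
  obtain ⟨n, s, hs, hsn, rfl⟩ := hT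
  obtain ⟨-, -, ⟨P, hP, ⟨Q, hT⟩, hPdeg⟩, hdeg⟩ := h
  rw [natDegree_X_pow_add_X_pow_add_one hsn] at hdeg
  have hQ₀ : Q ≠ 0 := by
    rintro rfl
    have := natDegree_X_pow_add_X_pow_add_one hsn
    rw [hT, mul_zero, natDegree_zero] at this
    omega
  have hQdeg : Q.natDegree = δ := by
    have := natDegree_X_pow_add_X_pow_add_one hsn
    rw [hT, natDegree_mul hP.ne_zero hQ₀, hPdeg] at this
    omega
  have hQT : Q ∣ X ^ n + X ^ s + 1 := hT ▸ dvd_mul_left Q P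
  have hQe := eval_ne_zero_of_dvd_trinomial hs hsn hQT
  have h₁ : δ ≠ 1 := hQdeg ▸ natDegree_ne_one_of_eval_ne_zero hQe
  have h₂ : δ ≠ 2 := by
    rintro rfl
    rw [eq_of_natDegree_eq_two hQe hQdeg, X_sq_add_X_add_one_dvd_trinomial_iff] at hQT
    omega
  have key : ∀ (k : ℕ) (P' Q' : (ZMod 2)[X]), Odd k → k < n → Irreducible P' →
      P'.natDegree = 216091 → Q'.natDegree = δ → X ^ n + X ^ k + 1 = P' * Q' →
      δ ≠ 0 ∧ δ ≠ 4 ∧ δ ≠ 6 := by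
    intro k P' Q' hk hkn hP' hP'deg hQ'deg hT'
    refine ⟨?_, ?_, ?_⟩
    · rintro rfl
      refine not_irreducible_trinomial_of_odd hk hkn hdeg ?_
      have hQ'₀ : Q' ≠ 0 := by
        rintro rfl
        have := natDegree_X_pow_add_X_pow_add_one hkn
        rw [hT', mul_zero, natDegree_zero] at this
        omega
      rw [hT', irreducible_mul_isUnit]
      · exact hP'
      · rw [isUnit_iff_degree_eq_zero, degree_eq_natDegree hQ'₀, hQ'deg, Nat.cast_zero]
    · rintro rfl
      exact natDegree_cofactor_ne_four hk hkn hdeg hP' hP'deg hT' hQ'deg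
    · rintro rfl
      exact natDegree_cofactor_ne_six hk hkn hdeg hP' hP'deg hT' hQ'deg
  have hrest : Odd n → δ ≠ 0 ∧ δ ≠ 4 ∧ δ ≠ 6 := by
    intro hn
    rcases Nat.even_or_odd s with hs' | hs'
    -- Reversing coefficients replaces `s` by the odd exponent `n - s` and keeps the degrees of both
    -- factors.
    · refine key (n - s) P.mirror Q.mirror (Nat.Odd.sub_even hsn.le hn hs') (by omega)
        (irreducible_mirror hP) (by rw [mirror_natDegree, hPdeg])
        (by rw [mirror_natDegree, hQdeg]) ?_
      rw [← mirror_X_pow_add_X_pow_add_one hs hsn, hT, mirror_mul_of_domain]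
    · exact key s P Q hs' hsn hP hPdeg hQdeg hT
  rw [Nat.odd_iff] at hrest
  simp only [Set.mem_insert_iff, Set.mem_singleton_iff]
  omega
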